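/- Let $F=\mathbb F_q$ be a finite field of odd order $q$. On the set $\mathrm{SL}(2,q)$ consider the following permutations: for $h\in \mathrm{SL}(2,q)$ let $\rho_h\colon x\mapsto xh$, and for $a\in \mathrm{GL}(2,q)$ let $\gamma_a\colon x\mapsto x^a:=a^{-1}xa$. Let $R=\{\rho_h\mid h\in \mathrm{SL}(2,q)\}$, let $\mathfrak A$ be the group of permutations of $\mathrm{SL}(2,q)$ induced by all automorphisms of the group $\mathrm{SL}(2,q)$, and let $\mathfrak A\ltimes R$ be the permutation group generated by $\mathfrak A$ and $R$; it is the internal semidirect product of its normal subgroup $R$ with $\mathfrak A$, hence isomorphic to $\mathrm{Aut}(\mathrm{SL}(2,q))\ltimes \mathrm{SL}(2,q)$. Let $\mathrm{P\Sigma L}(2,q):=\mathrm{PSL}(2,q)\rtimes \mathrm{Aut}(\mathbb F_q)$, where field automorphisms act entrywise on matrices. It acts on $\mathrm{SL}(2,q)$ by group automorphisms (the elements of $\mathrm{PSL}(2,q)$ by conjugation, field automorphisms entrywise); this action is faithful, and $\mathrm{P\Sigma L}(2,q)$ is identified with the corresponding subgroup of $\mathfrak A$. Let $T=\left\{\begin{pmatrix}1&x\\0&1\end{pmatrix}\;\middle|\;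 x\in\mathbb F_q\right\}$, let $\Omega$ be the set of all $g\in \mathrm{SL}(2,q)$ whose lower left entry is a square in $\mathbb F_q$ (where $0$ counts as a square), and put $$A:=\{Tg\mid g\in\Omega\}\cup\{gT\mid g\in \mathrm{SL}(2,q)\smallsetminus\Omega\},\qquad \pi_{\mathrm{odd}}:=\{A^h\mid h\in \mathrm{SL}(2,q)\},$$ where $A^h=\{h^{-1}Bh\mid B\in A\}$. The group $\mathfrak A\ltimes R$ acts on sets of sets of subsets of $\mathrm{SL}(2,q)$ in the natural way. Theorem. Let $c:=\begin{pmatrix}1&0\\0&-1\end{pmatrix}$. The stabilizer of $\pi_{\mathrm{odd}}$ in $\mathfrak A\ltimes R$ equals (a) the internal direct product $\mathrm{P\Sigma L}(2,q)\times\langle\rho_{-1}\rangle$ if $q\equiv 1 \pmod 4$, and (b) the internal semidirect product $\mathrm{P\Sigma L}(2,q)\rtimes\langle\gamma_c\cdot\rho_{-1}\rangle$ (with $\mathrm{P\Sigma L}(2,q)$ normal) if $q\equiv 3\pmod 4$. -/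

import Mathlib

open scoped Pointwise MatrixGroups

/-- `P` is the internal semidirect product `N ⋊ H` of its subgroups `N` (normal in `P`) and `H`. -/
structure IsInternalSemidirectProduct {G : Type*} [Group G] (P N H : Subgroup G) : Prop where
  sup_eq : N ⊔ H = P
  disjoint : Disjoint N H
  conj_mem : ∀ h ∈ H, ∀ n ∈ N, h * n * h⁻¹ ∈ N

/-- `P` is the internal direct product `N × H` of its subgroups `N` and `H`. -/
structure IsInternalDirectProduct {G : Type*} [Group G] (P N H : Subgroup G) : Prop where
  sup_eq : N ⊔ H = P
  disjoint : Disjoint N H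
  commute : ∀ n ∈ N, ∀ h ∈ H, Commute n h

namespace SLTwo

section

variable (F : Type*) [Field F]

/-- The permutation group `𝔄` of `SL(2,F)` induced by all group automorphisms of `SL(2,F)`. -/
def autGroup : Subgroup (Equiv.Perm SL(2, F)) :=
  (MulAut.toPerm SL(2, F)).range

variable {F} in
/-- `ρ_h : x ↦ x h`. -/
def rho (h : SL(2, F)) : Equiv.Perm SL(2, F) :=
  Equiv.mulRight h

/-- The permutation group `R = {ρ_h | h ∈ SL(2,F)}`. -/
def rightGroup : Subgroup (Equiv.Perm SL(2, F)) where
  carrier := Set.range rho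
  one_mem' := ⟨1, by ext1 x; simp [rho]⟩
  mul_mem' := by
    rintro _ _ ⟨g, rfl⟩ ⟨h, rfl⟩
    exact ⟨h * g, by ext1 x; simp [rho, mul_assoc]⟩
  inv_mem' := by
    rintro _ ⟨g, rfl⟩
    exact ⟨g⁻¹, by ext1 x; simp [rho]⟩

/-- The permutation group `𝔄 ⋉ R` of `SL(2,F)` generated by `𝔄` and `R`. -/
def affineGroup : Subgroup (Equiv.Perm SL(2, F)) :=
  rightGroup F ⊔ autGroup F

variable {F} in
/-- `γ_a : x ↦ a⁻¹ x a` for `a ∈ GL(2,F)`, as an automorphism of `SL(2,F)`. -/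
def gammaAut (a : GL (Fin 2) F) : MulAut SL(2, F) where
  toFun x := ⟨(a⁻¹ : GL (Fin 2) F) * x * a, by
    rw [Matrix.det_units_conj', x.det_coe]⟩
  invFun x := ⟨a * x * (a⁻¹ : GL (Fin 2) F), by
    rw [Matrix.det_units_conj, x.det_coe]⟩
  left_inv x := Subtype.ext <| by simp [mul_assoc]
  right_inv x := Subtype.ext <| by simp [mul_assoc]
  map_mul' x y := Subtype.ext <| by
    change ((a⁻¹ : GL (Fin 2) F) : Matrix (Fin 2) (Fin 2) F) *
        ((x : Matrix (Fin 2) (Fin 2) F) * (y : Matrix (Fin 2) (Fin 2) F)) * a =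
      ((a⁻¹ : GL (Fin 2) F) * (x : Matrix (Fin 2) (Fin 2) F) * a) *
        ((a⁻¹ : GL (Fin 2) F) * (y : Matrix (Fin 2) (Fin 2) F) * a)
    simp only [mul_assoc, Units.mul_inv_cancel_left]

variable {F} in
/-- `γ_a : x ↦ a⁻¹ x a` for `a ∈ GL(2,F)`, as a permutation of `SL(2,F)`. -/
def gamma (a : GL (Fin 2) F) : Equiv.Perm SL(2, F) :=
  MulAut.toPerm SL(2, F) (gammaAut a)

/-- The diagonal matrix `c = diag(1, -1)`. -/
def cMat : GL (Fin 2) F :=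
  Matrix.GeneralLinearGroup.mkOfDetNeZero !![1, 0; 0, -1] (by simp [Matrix.det_fin_two])

/-- The action of the field automorphisms on `SL(2,F)` by entrywise application. -/
def fieldAut : (F ≃+* F) →* MulAut SL(2, F) where
  toFun σ :=
    { toFun := Matrix.SpecialLinearGroup.map (σ : F →+* F)
      invFun := Matrix.SpecialLinearGroup.map (σ.symm : F →+* F)
      left_inv := fun x => by ext i j; simp
      right_inv := fun x => by ext i j; simp
      map_mul' := map_mul _ }
  map_one' := by ext x i j; simp
  map_mul' σ τ := by ext x i j; simp

/-- The action of the field automorphisms on `PSL(2,F)` by entrywise application to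
representatives. -/
def fieldAutPSL : (F ≃+* F) →* MulAut PSL(2, F) where
  toFun σ := QuotientGroup.congr _ _ (fieldAut F σ)
    (Subgroup.characteristic_iff_map_eq.mp inferInstance _)
  map_one' := by
    ext x
    induction x using QuotientGroup.induction_on with
    | H x => simp
  map_mul' σ τ := by
    ext x
    induction x using QuotientGroup.induction_on with
    | H x =>
      rw [map_mul]
      rfl

/-- The group `PΣL(2,F) = PSL(2,F) ⋊ Aut(F)`. -/
abbrev PSigmaL : Type _ :=
  PSL(2, F) ⋊[fieldAutPSL F] (F ≃+* F)

/-- The action of `PSL(2,F)` on `SL(2,F)` by conjugation. -/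
def pslAut : PSL(2, F) →* MulAut SL(2, F) :=
  QuotientGroup.lift (Subgroup.center SL(2, F)) MulAut.conj (by
    intro z hz
    ext1 x
    simp [← Subgroup.mem_center_iff.mp hz x])

/-- The natural action of `PΣL(2,F)` on `SL(2,F)`: elements of `PSL(2,F)` act by conjugation and
field automorphisms act entrywise. -/
def pSigmaLAut : PSigmaL F →* MulAut SL(2, F) :=
  SemidirectProduct.lift (pslAut F) (fieldAut F) (by
    intro σ
    ext x y : 3
    change MulAut.conj (fieldAut F σ x) y =
      fieldAut F σ (MulAut.conj x ((fieldAut F σ).symm y))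
    simp)

/-- `PΣL(2,F)` as a subgroup of `𝔄`. -/
def pSigmaLGroup : Subgroup (Equiv.Perm SL(2, F)) :=
  ((MulAut.toPerm SL(2, F)).comp (pSigmaLAut F)).range

/-- The subgroup `T` of all upper unitriangular matrices. -/
def T : Subgroup SL(2, F) where
  carrier := {g | ∃ x : F, (g : Matrix (Fin 2) (Fin 2) F) = !![1, x; 0, 1]}
  one_mem' := ⟨0, by simp [Matrix.one_fin_two]⟩
  mul_mem' := by
    rintro g h ⟨x, hx⟩ ⟨y, hy⟩
    exact ⟨y + x, by simp [hx, hy]⟩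
  inv_mem' := by
    rintro g ⟨x, hx⟩
    exact ⟨-x, by simp [Matrix.SpecialLinearGroup.coe_inv, hx, Matrix.adjugate_fin_two]⟩

/-- The set `Ω` of all matrices in `SL(2,F)` whose lower left entry is a square (possibly `0`). -/
def Omega : Set SL(2, F) :=
  {g | IsSquare (g 1 0)}

/-- `A = {T g | g ∈ Ω} ∪ {g T | g ∉ Ω}`. -/
def classA : Set (Set SL(2, F)) :=
  {B | ∃ g ∈ Omega F, B = (T F : Set SL(2, F)) * {g}} ∪
    {B | ∃ g ∉ Omega F, B = {g} * (T F : Set SL(2, F))}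

/-- `π_odd = {A ^ h | h ∈ SL(2,F)}`, where `A ^ h` is the image of `A` under `x ↦ h⁻¹ x h`. -/
def piOdd : Set (Set (Set SL(2, F))) :=
  {X | ∃ h : SL(2, F), X = (fun B : Set SL(2, F) => {h⁻¹} * B * {h}) '' classA F}

/-- The stabilizer of `π_odd` in `𝔄 ⋉ R`, i.e. the group of all `f ∈ 𝔄 ⋉ R` for which
`{{f(B) | B ∈ X} | X ∈ π_odd} = π_odd`. -/
def stabPiOdd : Subgroup (Equiv.Perm SL(2, F)) :=
  affineGroup F ⊓ MulAction.stabilizer (Equiv.Perm SL(2, F)) (piOdd F)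

end

end SLTwo

/-! For a nonzero scalar `e`, let A_e be the variant of A in which a matrix contributes Tg exactly
when `e` times its lower left entry is a square; its blocks are `block e g`, and A = A_1. Each A_e
is a partition of SL(2,F), depends only on the square class of `e`, is carried to A_{de} by the
diagonal automorphism `diagAut d`, and to A_{-e} by right translation by -1. Inner automorphisms
permute the conjugates of A, and field automorphisms fix A, so PΣL(2,F) stabilizes π_odd. The same
rules put ρ_{-1} (when -1 is a square) and γ_c ρ_{-1} in the stabilizer.

Conversely, an element of 𝔄 ⋉ R is a right translation after an automorphism, and every automorphism
is inner times diagonal times field (`exists_eq_conj_mul_diagAut_mul_fieldAut`). Modulo PΣL(2,F)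
only ρ_h composed with `diagAut e` remains, and it must carry A to a conjugate A^k, that is, ρ_h
carries A_e to A^k. Comparing the blocks that contain gh, for suitable g, shows that k normalizes T,
so A^k = A, and then that h is upper triangular with `e * h 0 0` a square
(`one_zero_eq_zero_and_isSquare_of_rho_smul`). Since inner automorphisms lie in the stabilizer, the
same holds for every conjugate of h. Hence h = 1 with e a square, or h = -1 with -e a square
(`eq_of_rho_mul_diagAut_mem_stabPiOdd`). A diagonal automorphism with square parameter is inner, so
only one extra generator is needed. -/

namespace SLTwo

/-! ### Unitriangular matrices and generation of SL(2,F). -/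

section Unitriangular

variable {F : Type*} [Field F]

/-- The upper unitriangular matrix with upper right entry `x`. -/
def upper (x : F) : SL(2, F) :=
  ⟨!![1, x; 0, 1], by simp [Matrix.det_fin_two]⟩

/-- The lower unitriangular matrix with lower left entry `x`. -/
def lower (x : F) : SL(2, F) :=
  ⟨!![1, 0; x, 1], by simp [Matrix.det_fin_two]⟩

theorem ext_entries {g h : SL(2, F)} (h₀₀ : g 0 0 = h 0 0) (h₀₁ : g 0 1 = h 0 1)
    (h₁₀ : g 1 0 = h 1 0) (h₁₁ : g 1 1 = h 1 1) : g = h := by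
  ext i j
  fin_cases i <;> fin_cases j <;> assumption

@[simp] theorem upper_zero_zero (x : F) : upper x 0 0 = 1 := rfl
@[simp] theorem upper_zero_one (x : F) : upper x 0 1 = x := rfl
@[simp] theorem upper_one_zero (x : F) : upper x 1 0 = 0 := rfl
@[simp] theorem upper_one_one (x : F) : upper x 1 1 = 1 := rfl
@[simp] theorem lower_zero_zero (x : F) : lower x 0 0 = 1 := rfl
@[simp] theorem lower_zero_one (x : F) : lower x 0 1 = 0 := rfl
@[simp] theorem lower_one_zero (x : F) : lower x 1 0 = x := rfl
@[simp] theorem lower_one_one (x : F) : lower x 1 1 = 1 := rfl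

theorem mul_entry (g h : SL(2, F)) (i j : Fin 2) :
    (g * h) i j = g i 0 * h 0 j + g i 1 * h 1 j := by
  change ((g : Matrix (Fin 2) (Fin 2) F) * (h : Matrix (Fin 2) (Fin 2) F)) i j = _
  rw [Matrix.mul_apply, Fin.sum_univ_two]

theorem inv_zero_zero (g : SL(2, F)) : g⁻¹ 0 0 = g 1 1 := by
  simp [Matrix.SpecialLinearGroup.coe_inv, Matrix.adjugate_fin_two]

theorem inv_zero_one (g : SL(2, F)) : g⁻¹ 0 1 = -g 0 1 := by
  simp [Matrix.SpecialLinearGroup.coe_inv, Matrix.adjugate_fin_two]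

theorem inv_one_zero (g : SL(2, F)) : g⁻¹ 1 0 = -g 1 0 := by
  simp [Matrix.SpecialLinearGroup.coe_inv, Matrix.adjugate_fin_two]

theorem inv_one_one (g : SL(2, F)) : g⁻¹ 1 1 = g 0 0 := by
  simp [Matrix.SpecialLinearGroup.coe_inv, Matrix.adjugate_fin_two]

theorem det_entries (g : SL(2, F)) : g 0 0 * g 1 1 - g 0 1 * g 1 0 = 1 := by
  rw [← Matrix.det_fin_two, g.det_coe]

theorem upper_add (x y : F) : upper (x + y) = upper x * upper y := by
  apply ext_entries <;> simp [mul_entry, add_comm]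

theorem upper_injective : Function.Injective (upper : F → SL(2, F)) := fun x y h => by
  simpa using congrArg (fun g : SL(2, F) => g 0 1) h

theorem lower_injective : Function.Injective (lower : F → SL(2, F)) := fun x y h => by
  simpa using congrArg (fun g : SL(2, F) => g 1 0) h

theorem upper_mem_T (x : F) : upper x ∈ T F := ⟨x, rfl⟩

theorem mem_T_iff_exists {g : SL(2, F)} : g ∈ T F ↔ ∃ x, g = upper x :=
  ⟨fun ⟨x, hx⟩ => ⟨x, Subtype.ext hx⟩, fun ⟨x, hx⟩ => ⟨x, congrArg Subtype.val hx⟩⟩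

theorem mem_T_iff {g : SL(2, F)} : g ∈ T F ↔ g 0 0 = 1 ∧ g 1 0 = 0 ∧ g 1 1 = 1 := by
  rw [mem_T_iff_exists]
  constructor
  · rintro ⟨x, rfl⟩
    simp
  · rintro ⟨h₁, h₂, h₃⟩
    exact ⟨g 0 1, ext_entries (by simpa) (by simp) (by simpa) (by simpa)⟩

theorem eq_upper_mul_lower_mul_upper {g : SL(2, F)} (hg : g 1 0 ≠ 0) :
    g = upper ((g 0 0 - 1) / g 1 0) * lower (g 1 0) * upper ((g 1 1 - 1) / g 1 0) := by
  have hd := det_entries g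
  apply ext_entries <;> simp [mul_entry] <;> field_simp <;> first | ring1 | linear_combination -hd

/-- Two automorphisms of `SL(2,F)` agreeing on all unitriangular matrices are equal. -/
theorem mulAut_ext {α β : MulAut SL(2, F)} (hu : ∀ x, α (upper x) = β (upper x))
    (hl : ∀ x, α (lower x) = β (lower x)) : α = β := by
  have key : ∀ g : SL(2, F), g 1 0 ≠ 0 → α g = β g := fun g hg => by
    rw [eq_upper_mul_lower_mul_upper hg]
    simp [hu, hl]
  ext1 g
  by_cases hg : g 1 0 = 0
  · have hd := det_entries g
    -- For upper triangular `g` the lower left entry of `lower 1 * g` is `g 0 0`, which is nonzero.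
    have h₁ : α (lower 1 * g) = β (lower 1 * g) := by
      apply key
      intro h
      simp [mul_entry, hg] at h
      simp [h, hg] at hd
    simpa [hl] using h₁
  · exact key g hg

end Unitriangular

/-! ### Diagonal and field automorphisms, Weyl elements. -/

section Automorphisms

variable {F : Type*} [Field F]

/-- The diagonal matrix `diag(1, e)`. -/
def diagOne (e : F) (he : e ≠ 0) : GL (Fin 2) F :=
  Matrix.GeneralLinearGroup.mkOfDetNeZero !![1, 0; 0, e] (by simpa [Matrix.det_fin_two])

theorem coe_diagOne_inv (e : F) (he : e ≠ 0) :
    (((diagOne e he)⁻¹ : GL (Fin 2) F) : Matrix (Fin 2) (Fin 2) F) = !![1, 0; 0, e⁻¹] := by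
  have h : diagOne e he * diagOne e⁻¹ (inv_ne_zero he) = 1 := by
    ext i j
    fin_cases i <;> fin_cases j <;>
      simp [diagOne, Matrix.GeneralLinearGroup.mkOfDetNeZero, Matrix.mul_apply, he]
  rw [inv_eq_of_mul_eq_one_right h]
  rfl

/-- Conjugation by `diag(1, e)`. -/
def diagAut (e : F) (he : e ≠ 0) : MulAut SL(2, F) :=
  gammaAut (diagOne e he)

theorem coe_diagAut (e : F) (he : e ≠ 0) (g : SL(2, F)) :
    (diagAut e he g : Matrix (Fin 2) (Fin 2) F) =
      !![g 0 0, e * g 0 1; e⁻¹ * g 1 0, g 1 1] := by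
  change (((diagOne e he)⁻¹ : GL (Fin 2) F) : Matrix (Fin 2) (Fin 2) F) * g *
    (!![1, 0; 0, e] : Matrix (Fin 2) (Fin 2) F) = _
  rw [coe_diagOne_inv, Matrix.eta_fin_two (g : Matrix (Fin 2) (Fin 2) F)]
  ext i j
  fin_cases i <;> fin_cases j <;> simp [mul_comm, mul_left_comm, he]

@[simp] theorem diagAut_zero_zero (e : F) (he : e ≠ 0) (g : SL(2, F)) :
    diagAut e he g 0 0 = g 0 0 := by rw [coe_diagAut]; rfl
@[simp] theorem diagAut_zero_one (e : F) (he : e ≠ 0) (g : SL(2, F)) :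
    diagAut e he g 0 1 = e * g 0 1 := by rw [coe_diagAut]; rfl
@[simp] theorem diagAut_one_zero (e : F) (he : e ≠ 0) (g : SL(2, F)) :
    diagAut e he g 1 0 = e⁻¹ * g 1 0 := by rw [coe_diagAut]; rfl
@[simp] theorem diagAut_one_one (e : F) (he : e ≠ 0) (g : SL(2, F)) :
    diagAut e he g 1 1 = g 1 1 := by rw [coe_diagAut]; rfl

theorem gammaAut_cMat : gammaAut (cMat F) = diagAut (-1) (neg_ne_zero.mpr one_ne_zero) := rfl

@[simp] theorem fieldAut_entry (σ : F ≃+* F) (g : SL(2, F)) (i j : Fin 2) :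
    fieldAut F σ g i j = σ (g i j) := rfl

theorem diagAut_upper (e : F) (he : e ≠ 0) (x : F) : diagAut e he (upper x) = upper (e * x) := by
  apply ext_entries <;> simp

theorem diagAut_lower (e : F) (he : e ≠ 0) (x : F) :
    diagAut e he (lower x) = lower (e⁻¹ * x) := by
  apply ext_entries <;> simp

theorem fieldAut_upper (σ : F ≃+* F) (x : F) : fieldAut F σ (upper x) = upper (σ x) := by
  apply ext_entries <;> simp

theorem fieldAut_lower (σ : F ≃+* F) (x : F) : fieldAut F σ (lower x) = lower (σ x) := by
  apply ext_entries <;> simp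

theorem exists_conj_eq_diagAut_sq (s : F) (hs : s * s ≠ 0) :
    ∃ u, MulAut.conj u = diagAut (s * s) hs := by
  have hs₀ : s ≠ 0 := fun h => hs (by simp [h])
  obtain ⟨u, h₁, h₂, h₃, h₄⟩ : ∃ u : SL(2, F),
      u 0 0 = s ∧ u 0 1 = 0 ∧ u 1 0 = 0 ∧ u 1 1 = s⁻¹ :=
    ⟨⟨!![s, 0; 0, s⁻¹], by simp [Matrix.det_fin_two, hs₀]⟩, rfl, rfl, rfl, rfl⟩
  refine ⟨u, ?_⟩
  ext1 g
  apply ext_entries <;>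
    simp only [MulAut.conj_apply, mul_entry, diagAut_zero_zero, diagAut_zero_one,
      diagAut_one_zero, diagAut_one_one, inv_zero_zero, inv_zero_one, inv_one_zero,
      inv_one_one, h₁, h₂, h₃, h₄] <;>
    field_simp <;> ring

/-- The upper right entry of the conjugate is `x * (w 0 0) ^ 2`. -/
theorem zero_zero_eq_zero_of_conj_upper_eq_lower {w : SL(2, F)} {x y : F} (hx : x ≠ 0)
    (hw : w * upper x * w⁻¹ = lower y) : w 0 0 = 0 := by
  have h := congrArg (fun g : SL(2, F) => g 0 1) hw
  simp only [mul_entry, inv_zero_one, inv_one_one] at h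
  simp at h
  have : x * (w 0 0 * w 0 0) = 0 := by linear_combination h
  simpa [hx] using this

theorem weyl_conj_upper {w : SL(2, F)} (hw : w 0 0 = 0) (x : F) :
    w * upper x * w⁻¹ = lower (-(w 1 0) ^ 2 * x) := by
  have hd := det_entries w
  apply ext_entries <;>
    simp only [mul_entry, inv_zero_zero, inv_zero_one, inv_one_zero, inv_one_one] <;>
    simp [hw] <;> simp [hw] at hd
  · linear_combination hd
  · ring
  · linear_combination hd

/-- The antidiagonal matrix with entries `x` and `-x⁻¹`, as a product of unitriangular ones. -/
def weyl (x : F) : SL(2, F) :=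
  upper x * lower (-x⁻¹) * upper x

theorem weyl_entries {x : F} (hx : x ≠ 0) :
    weyl x 0 0 = 0 ∧ weyl x 0 1 = x ∧ weyl x 1 0 = -x⁻¹ ∧ weyl x 1 1 = 0 := by
  simp [weyl, mul_entry, hx]

/-- The conjugating element is the diagonal matrix with entries `x / z` and `z / x`. Written with
Weyl elements, it is a word in unitriangular matrices, so an automorphism can be tracked through it.
-/
theorem weyl_mul_inv_conj_upper {x z : F} (hx : x ≠ 0) (hz : z ≠ 0) (y : F) :
    weyl x * (weyl z)⁻¹ * upper y * (weyl x * (weyl z)⁻¹)⁻¹ = upper ((x / z) ^ 2 * y) := by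
  obtain ⟨h₁, h₂, h₃, h₄⟩ := weyl_entries hx
  obtain ⟨k₁, k₂, k₃, k₄⟩ := weyl_entries hz
  apply ext_entries <;>
    simp only [mul_entry, inv_zero_zero, inv_zero_one, inv_one_zero, inv_one_one,
      h₁, h₂, h₃, h₄, k₁, k₂, k₃, k₄, upper_zero_zero, upper_zero_one, upper_one_zero,
      upper_one_one] <;>
    field_simp <;> ring

end Automorphisms

/-! ### Automorphisms preserving both unitriangular subgroups. -/

section FixedPair

variable {F : Type*} [Field F]

/-- An automorphism preserving both unitriangular subgroups is the composition of a diagonal and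
a field automorphism. -/
theorem exists_eq_diagAut_mul_fieldAut [Finite F] (h2 : (2 : F) ≠ 0) (β : MulAut SL(2, F))
    (hu : ∀ x, ∃ y, β (upper x) = upper y) (hl : ∀ x, ∃ y, β (lower x) = lower y) :
    ∃ (e : F) (he : e ≠ 0) (σ : F ≃+* F), β = diagAut e he * fieldAut F σ := by
  choose f hf using hu
  choose g hg using hl
  have f_add : ∀ x y, f (x + y) = f x + f y := fun x y => by
    apply upper_injective
    rw [← hf, upper_add, upper_add, map_mul, hf, hf]
  have f_inj : Function.Injective f := fun x y h => by
    apply upper_injective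
    apply β.injective
    rw [hf, hf, h]
  have f_zero : f 0 = 0 := by simpa using f_add 0 0
  have f_ne : ∀ x, x ≠ 0 → f x ≠ 0 := fun x hx h => hx (f_inj (h.trans f_zero.symm))
  -- The image of a Weyl element still conjugates an upper unitriangular matrix to a lower one, so
  -- its top left entry `1 + f x * g (-x⁻¹)` vanishes. Thus `f` determines `g`.
  have hw : ∀ x, x ≠ 0 → g (-x⁻¹) = -(f x)⁻¹ := fun x hx => by
    have h₁ : β (weyl x) 0 0 = 0 := by
      apply zero_zero_eq_zero_of_conj_upper_eq_lower (f_ne 1 one_ne_zero)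
      rw [← hf, ← map_inv, ← map_mul, ← map_mul, weyl_conj_upper (weyl_entries hx).1, hg]
    simp only [weyl, map_mul, hf, hg] at h₁
    simp [mul_entry] at h₁
    have := f_ne x hx
    generalize g (-x⁻¹) = z at *
    field_simp
    linear_combination h₁
  have β_weyl : ∀ x, x ≠ 0 → β (weyl x) = weyl (f x) := fun x hx => by
    simp only [weyl, map_mul, hf, hg, hw x hx]
  have f_sq : ∀ x y, f (x * x * y) * (f 1 * f 1) = f x * f x * f y := fun x y => by
    rcases eq_or_ne x 0 with rfl | hx
    · simp [f_zero]
    · have h := congrArg β (weyl_mul_inv_conj_upper hx one_ne_zero y)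
      simp only [map_mul, map_inv, β_weyl _ hx, β_weyl _ one_ne_zero, hf] at h
      have h1 := f_ne 1 one_ne_zero
      rw [weyl_mul_inv_conj_upper (f_ne x hx) h1] at h
      have h' := upper_injective h
      rw [div_one, sq x] at h'
      rw [← h']
      field_simp
  set e := f 1 with he_def
  have he : e ≠ 0 := f_ne 1 one_ne_zero
  -- Polarization of the squaring identity; this is where 2 must be invertible. It makes `f / e` a
  -- ring homomorphism.
  have f_mul : ∀ x y, f (x * y) * e = f x * f y := fun x y => by
    have hsq : ∀ x, f (x * x) * e = f x * f x := fun x => by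
      have := f_sq x 1
      rw [mul_one, ← he_def] at this
      apply mul_right_cancel₀ he
      linear_combination this
    have h₁ := hsq (x + y)
    have h₂ : (x + y) * (x + y) = x * x + (x * y + x * y) + y * y := by ring
    rw [h₂] at h₁
    simp only [f_add] at h₁
    apply mul_left_cancel₀ h2
    linear_combination h₁ - hsq x - hsq y
  let φ : F →+* F :=
    { toFun := fun x => f x / e
      map_one' := div_self he
      map_zero' := by simp [f_zero]
      map_add' := fun x y => by rw [f_add, add_div]
      map_mul' := fun x y => by
        field_simp
        linear_combination f_mul x y }
  have hφ : Function.Bijective φ := Finite.injective_iff_bijective.mp φ.injective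
  have hfφ : ∀ x, f x = e * φ x := fun x => by
    change f x = e * (f x / e)
    field_simp
  refine ⟨e, he, RingEquiv.ofBijective φ hφ, mulAut_ext (fun x => ?_) (fun x => ?_)⟩
  · rw [hf, MulAut.mul_apply, fieldAut_upper, diagAut_upper, hfφ]
    rfl
  · rw [hg, MulAut.mul_apply, fieldAut_lower, diagAut_lower]
    congr 1
    change g x = e⁻¹ * φ x
    rcases eq_or_ne x 0 with rfl | hx
    · apply lower_injective
      rw [map_zero, mul_zero, ← hg]
      have : (lower 0 : SL(2, F)) = 1 := by apply ext_entries <;> simp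
      rw [this, map_one]
    · have := hw (-x⁻¹) (by simpa using hx)
      rw [hfφ, map_neg, map_inv₀] at this
      simpa [mul_comm] using this
end FixedPair
-- T as a Sylow subgroup in the defining characteristic.
section Sylow

variable {F : Type*} [Field F]

theorem upper_pow (x : F) (n : ℕ) : upper x ^ n = upper (n * x) := by
  induction n with
  | zero => apply ext_entries <;> simp
  | succ n ih => rw [pow_succ, ih, ← upper_add]; push_cast; ring_nf

theorem isPGroup_T (p : ℕ) [CharP F p] : IsPGroup p (T F) := by
  rintro ⟨g, hg⟩
  obtain ⟨x, rfl⟩ := mem_T_iff_exists.mp hg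
  refine ⟨1, Subtype.ext ?_⟩
  change upper x ^ p ^ 1 = 1
  rw [upper_pow]
  apply ext_entries <;> simp

/-- In characteristic p, (g - 1)^(p^n) = g^(p^n) - 1 = 0, so g - 1 is nilpotent and has trace 0. -/
theorem trace_eq_two_of_pow_eq_one {p : ℕ} [Fact p.Prime] [CharP F p] {g : SL(2, F)} {n : ℕ}
    (hg : g ^ p ^ n = 1) : g 0 0 + g 1 1 = 2 := by
  have h : IsNilpotent ((g : Matrix (Fin 2) (Fin 2) F) - 1) := by
    refine ⟨p ^ n, ?_⟩
    rw [sub_pow_char_pow_of_commute _ _ (Commute.one_right _), one_pow,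
      ← Matrix.SpecialLinearGroup.coe_pow, hg, Matrix.SpecialLinearGroup.coe_one, sub_self]
  have := (Matrix.isNilpotent_trace_of_isNilpotent h).eq_zero
  rw [Matrix.trace_sub, Matrix.trace_one, Matrix.trace_fin_two] at this
  simpa using sub_eq_zero.mp this

/-- In characteristic `p`, the group `T` is a Sylow `p`-subgroup of `SL(2,F)`. -/
def sylowT (F : Type*) [Field F] (p : ℕ) [Fact p.Prime] [CharP F p] : Sylow p SL(2, F) where
  toSubgroup := T F
  isPGroup' := isPGroup_T p
  is_maximal' := by
    intro Q hQ hTQ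
    refine le_antisymm (fun g hg => ?_) hTQ
    have key : ∀ x ∈ Q, x 0 0 + x 1 1 = 2 := fun x hx => by
      obtain ⟨n, hn⟩ := hQ ⟨x, hx⟩
      exact trace_eq_two_of_pow_eq_one (p := p) (n := n) (congrArg Subtype.val hn)
    have h₁ := key g hg
    -- Left multiplication by `upper 1` adds `g 1 0` to the trace, so equality of the two traces
    -- forces `g 1 0 = 0`.
    have h₂ := key _ (Q.mul_mem (hTQ (upper_mem_T 1)) hg)
    simp [mul_entry] at h₂
    have hc : g 1 0 = 0 := by linear_combination h₂ - h₁
    have hd := det_entries g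
    rw [hc] at hd
    have ha : g 0 0 = 1 := by
      have : (g 0 0 - 1) * (g 0 0 - 1) = 0 := by linear_combination g 0 0 * h₁ - hd
      simpa [sub_eq_zero] using this
    exact mem_T_iff.mpr ⟨ha, hc, by linear_combination h₁ - ha⟩

end Sylow

/-! ### Structure of the automorphisms of SL(2,F). -/

section AutomorphismTheorem

variable {F : Type*} [Field F]

/-- The top left entries of the two sides are `g 0 0 + g 1 0` and `g 0 0`. So a single element of T
detects that g normalizes T. -/
theorem one_zero_eq_zero_of_upper_one_mul_eq {g t : SL(2, F)} (ht : t ∈ T F)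
    (h : upper 1 * g = g * t) : g 1 0 = 0 := by
  obtain ⟨x, rfl⟩ := mem_T_iff_exists.mp ht
  simpa [mul_entry] using congrArg (fun g : SL(2, F) => g 0 0) h

/-- Every automorphism of `SL(2,F)` maps `T` to a conjugate of `T`. -/
theorem exists_conj_mem_T [Finite F] (α : MulAut SL(2, F)) :
    ∃ u : SL(2, F), ∀ g ∈ T F, u * α g * u⁻¹ ∈ T F := by
  obtain ⟨p, hp⟩ := CharP.exists F
  have : Fact p.Prime := ⟨CharP.char_is_prime F p⟩
  obtain ⟨u, hu⟩ := MulAction.exists_smul_eq SL(2, F) (α • sylowT F p) (sylowT F p)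
  refine ⟨u, fun g hg => ?_⟩
  have h : MulAut.conj u • α • g ∈ (u • α • sylowT F p : Sylow p SL(2, F)) :=
    Subgroup.smul_mem_pointwise_smul _ _ _ (Subgroup.smul_mem_pointwise_smul _ _ _ hg)
  rw [hu] at h
  exact h

/-- Every automorphism of `SL(2,F)`, where `F` is a finite field of odd order, is the composition
of an inner, a diagonal and a field automorphism. -/
theorem exists_eq_conj_mul_diagAut_mul_fieldAut [Finite F] (h2 : (2 : F) ≠ 0)
    (α : MulAut SL(2, F)) :
    ∃ (u : SL(2, F)) (e : F) (he : e ≠ 0) (σ : F ≃+* F),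
      α = MulAut.conj u * (diagAut e he * fieldAut F σ) := by
  obtain ⟨u, hu⟩ := exists_conj_mem_T α
  obtain ⟨v, hv⟩ := exists_conj_mem_T
    (MulAut.conj u * α * MulAut.conj (weyl (1 : F)))
  obtain ⟨w₁, -, -, -⟩ := weyl_entries (one_ne_zero (α := F))
  set β := MulAut.conj u * α with hβ
  have hlow : ∀ x : F, lower x = weyl 1 * upper (-x) * (weyl 1)⁻¹ := fun x => by
    rw [weyl_conj_upper w₁, (weyl_entries one_ne_zero).2.2.1]
    simp
  have hβT : ∀ x, ∃ y, β (upper x) = upper y := fun x =>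
    mem_T_iff_exists.mp (hu _ (upper_mem_T x))
  have hvT : ∀ x, ∃ y, v * β (lower x) * v⁻¹ = upper y := fun x => by
    rw [hlow]
    exact mem_T_iff_exists.mp (hv _ (upper_mem_T (-x)))
  -- Otherwise `v` normalizes T, so `β` sends `lower 1` into T. By finiteness `β` already maps T
  -- onto itself, contradicting injectivity.
  have hv₀ : v 1 0 ≠ 0 := fun h => by
    obtain ⟨y, hy⟩ := hvT 1
    have hz : β (lower 1) ∈ T F := by
      have hd := det_entries v
      rw [h, mul_zero, sub_zero] at hd
      have hz : β (lower 1) = v⁻¹ * upper y * v := by rw [← hy]; group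
      rw [hz, mem_T_iff]
      simp only [mul_entry, inv_zero_zero, inv_zero_one, inv_one_zero, inv_one_one, h]
      simp only [upper_zero_zero, upper_one_zero, upper_zero_one, upper_one_one]
      exact ⟨by linear_combination hd, by ring, by linear_combination hd⟩
    choose f hf using hβT
    have f_inj : Function.Injective f := fun x y hxy =>
      upper_injective (β.injective (by rw [hf, hf, hxy]))
    obtain ⟨y', hy'⟩ := mem_T_iff_exists.mp hz
    obtain ⟨x, rfl⟩ := Finite.surjective_of_injective f_inj y'
    rw [← hf] at hy'
    simpa using congrArg (fun g : SL(2, F) => g 1 0) (β.injective hy')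
  -- This `t` kills the top left entry of `upper t * v⁻¹`, so conjugation by `upper t` keeps T and
  -- moves the image of the lower unitriangular group back to that group.
  obtain ⟨t, ht⟩ : ∃ t : F, t = v 1 1 / v 1 0 := ⟨_, rfl⟩
  have hw : (upper t * v⁻¹) 0 0 = 0 := by
    rw [mul_entry, inv_zero_zero, inv_one_zero, ht]
    simp only [upper_zero_zero, upper_zero_one]
    field_simp
    ring
  obtain ⟨e, he, σ, h⟩ := exists_eq_diagAut_mul_fieldAut h2 (MulAut.conj (upper t) * β)
    (fun x => by
      obtain ⟨y, hy⟩ := hβT x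
      rw [MulAut.mul_apply, hy, MulAut.conj_apply]
      exact mem_T_iff_exists.mp ((T F).mul_mem ((T F).mul_mem (upper_mem_T _) (upper_mem_T _))
        ((T F).inv_mem (upper_mem_T _))))
    (fun x => by
      obtain ⟨y, hy⟩ := hvT x
      have hz : MulAut.conj (upper t) (β (lower x)) =
          upper t * v⁻¹ * upper y * (upper t * v⁻¹)⁻¹ := by
        rw [← hy, MulAut.conj_apply]
        group
      rw [MulAut.mul_apply, hz, weyl_conj_upper hw]
      exact ⟨_, rfl⟩)
  refine ⟨(upper t * u)⁻¹, e, he, σ, ?_⟩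
  rw [← h, hβ, map_inv, map_mul]
  group

end AutomorphismTheorem
-- The twisted partitions and how permutations act on them.
section Blocks

variable {F : Type*} [Field F]

open Classical in
/-- The right coset `T g` if `e` times the lower left entry of `g` is a square, and the left coset
`g T` otherwise. -/
def block (e : F) (g : SL(2, F)) : Set SL(2, F) :=
  if IsSquare (e * g 1 0) then (T F : Set SL(2, F)) * {g} else {g} * (T F : Set SL(2, F))

theorem block_of_isSquare {e : F} {g : SL(2, F)} (h : IsSquare (e * g 1 0)) :
    block e g = (T F : Set SL(2, F)) * {g} := if_pos h

theorem block_of_not_isSquare {e : F} {g : SL(2, F)} (h : ¬IsSquare (e * g 1 0)) :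
    block e g = {g} * (T F : Set SL(2, F)) := if_neg h

theorem classA_eq_range_block : classA F = Set.range (block (1 : F)) := by
  ext B
  constructor
  · rintro (⟨g, hg, rfl⟩ | ⟨g, hg, rfl⟩)
    · exact ⟨g, block_of_isSquare (by rwa [one_mul])⟩
    · exact ⟨g, block_of_not_isSquare (by rwa [one_mul])⟩
  · rintro ⟨g, rfl⟩
    by_cases hg : IsSquare (1 * g 1 0)
    · exact Or.inl ⟨g, by rwa [one_mul] at hg, block_of_isSquare hg⟩
    · exact Or.inr ⟨g, by rwa [one_mul] at hg, block_of_not_isSquare hg⟩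

theorem mem_T_mul_singleton {g x : SL(2, F)} :
    x ∈ (T F : Set SL(2, F)) * {g} ↔ x * g⁻¹ ∈ T F := by
  rw [Set.mul_singleton, Set.mem_image]
  exact ⟨by rintro ⟨t, ht, rfl⟩; simpa using ht, fun h => ⟨_, h, by group⟩⟩

theorem mem_singleton_mul_T {g x : SL(2, F)} :
    x ∈ {g} * (T F : Set SL(2, F)) ↔ g⁻¹ * x ∈ T F := by
  rw [Set.singleton_mul, Set.mem_image]
  exact ⟨by rintro ⟨t, ht, rfl⟩; simpa using ht, fun h => ⟨_, h, by group⟩⟩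

theorem T_mul_singleton_congr {g x : SL(2, F)} (h : x * g⁻¹ ∈ T F) :
    (T F : Set SL(2, F)) * {g} = (T F : Set SL(2, F)) * {x} := by
  ext y
  rw [mem_T_mul_singleton, mem_T_mul_singleton,
    show y * g⁻¹ = y * x⁻¹ * (x * g⁻¹) by group, (T F).mul_mem_cancel_right h]

theorem singleton_mul_T_congr {g x : SL(2, F)} (h : g⁻¹ * x ∈ T F) :
    {g} * (T F : Set SL(2, F)) = {x} * (T F : Set SL(2, F)) := by
  ext y
  rw [mem_singleton_mul_T, mem_singleton_mul_T,
    show g⁻¹ * y = g⁻¹ * x * (x⁻¹ * y) by group, (T F).mul_mem_cancel_left h]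

theorem mul_one_zero_of_mem_T_left {t : SL(2, F)} (ht : t ∈ T F) (g : SL(2, F)) :
    (t * g) 1 0 = g 1 0 := by
  obtain ⟨x, rfl⟩ := mem_T_iff_exists.mp ht
  simp [mul_entry]

theorem mul_one_zero_of_mem_T_right {t : SL(2, F)} (ht : t ∈ T F) (g : SL(2, F)) :
    (g * t) 1 0 = g 1 0 := by
  obtain ⟨x, rfl⟩ := mem_T_iff_exists.mp ht
  simp [mul_entry]

/-- The sets `block e g` form a partition. -/
theorem block_eq_of_mem {e : F} {g x : SL(2, F)} (hx : x ∈ block e g) :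
    block e g = block e x := by
  by_cases h : IsSquare (e * g 1 0)
  · rw [block_of_isSquare h, mem_T_mul_singleton] at hx
    have h' : x 1 0 = g 1 0 := by simpa using mul_one_zero_of_mem_T_left hx g
    rw [block_of_isSquare h, block_of_isSquare (by rwa [h']), T_mul_singleton_congr hx]
  · rw [block_of_not_isSquare h, mem_singleton_mul_T] at hx
    have h' : x 1 0 = g 1 0 := by simpa using mul_one_zero_of_mem_T_right hx g
    rw [block_of_not_isSquare h, block_of_not_isSquare (by rwa [h']), singleton_mul_T_congr hx]

theorem self_mem_block (e : F) (g : SL(2, F)) : g ∈ block e g := by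
  by_cases h : IsSquare (e * g 1 0)
  · rw [block_of_isSquare h, mem_T_mul_singleton]
    simp [(T F).one_mem]
  · rw [block_of_not_isSquare h, mem_singleton_mul_T]
    simp [(T F).one_mem]

theorem one_zero_eq_zero_of_cosets_eq {g : SL(2, F)}
    (h : (T F : Set SL(2, F)) * {g} = {g} * (T F : Set SL(2, F))) : g 1 0 = 0 := by
  have : upper 1 * g ∈ (T F : Set SL(2, F)) * {g} := by
    rw [mem_T_mul_singleton]
    simpa using upper_mem_T 1
  rw [h, mem_singleton_mul_T] at this
  exact one_zero_eq_zero_of_upper_one_mul_eq this (by group)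

/-- The permutation of `SL(2,F)` given by an automorphism. -/
abbrev autPerm (α : MulAut SL(2, F)) : Equiv.Perm SL(2, F) :=
  MulAut.toPerm SL(2, F) α

theorem autPerm_smul_mul (α : MulAut SL(2, F)) (B C : Set SL(2, F)) :
    autPerm α • (B * C) = autPerm α • B * autPerm α • C :=
  Set.image_mul α

theorem autPerm_smul_singleton (α : MulAut SL(2, F)) (g : SL(2, F)) :
    autPerm α • ({g} : Set SL(2, F)) = {α g} :=
  Set.image_singleton

theorem autPerm_smul_block {e e' : F} {α : MulAut SL(2, F)}
    (hT : autPerm α • (T F : Set SL(2, F)) = T F)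
    (hα : ∀ g : SL(2, F), IsSquare (e * g 1 0) ↔ IsSquare (e' * α g 1 0)) (g : SL(2, F)) :
    autPerm α • block e g = block e' (α g) := by
  by_cases h : IsSquare (e * g 1 0)
  · rw [block_of_isSquare h, block_of_isSquare ((hα g).mp h), autPerm_smul_mul, hT,
      autPerm_smul_singleton]
  · rw [block_of_not_isSquare h, block_of_not_isSquare (mt (hα g).mpr h), autPerm_smul_mul, hT,
      autPerm_smul_singleton]

theorem autPerm_smul_range_block {e e' : F} {α : MulAut SL(2, F)}
    (hT : autPerm α • (T F : Set SL(2, F)) = T F)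
    (hα : ∀ g : SL(2, F), IsSquare (e * g 1 0) ↔ IsSquare (e' * α g 1 0)) :
    autPerm α • Set.range (block e) = Set.range (block e') := by
  rw [Set.smul_set_range]
  simp_rw [autPerm_smul_block hT hα]
  exact α.surjective.range_comp (block e')

theorem autPerm_smul_T {α : MulAut SL(2, F)} (hα : ∀ g, α g ∈ T F ↔ g ∈ T F) :
    autPerm α • (T F : Set SL(2, F)) = T F := by
  ext g
  rw [Set.mem_smul_set_iff_inv_smul_mem, ← map_inv]
  change α⁻¹ g ∈ T F ↔ _
  rw [← hα]
  simp

/-- The automorphism divides the lower left entry by `e`, and the new twist `e * e'` compensates for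
this. -/
theorem autPerm_diagAut_smul (e e' : F) (he : e ≠ 0) :
    autPerm (diagAut e he) • Set.range (block e') = Set.range (block (e * e')) :=
  autPerm_smul_range_block (autPerm_smul_T fun g => by simp [mem_T_iff, he])
    (fun g => by
      rw [diagAut_one_zero, show e * e' * (e⁻¹ * g 1 0) = e' * g 1 0 by field_simp])

theorem autPerm_fieldAut_smul (σ : F ≃+* F) :
    autPerm (fieldAut F σ) • Set.range (block (1 : F)) = Set.range (block 1) :=
  autPerm_smul_range_block (autPerm_smul_T fun g => by simp [mem_T_iff])
    (fun g => by
      rw [one_mul, one_mul, fieldAut_entry]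
      exact ⟨fun h => h.map σ, fun h => by simpa using h.map σ.symm⟩)

theorem conj_mem_T {u g : SL(2, F)} (hu : u 1 0 = 0) (hg : g ∈ T F) : u * g * u⁻¹ ∈ T F := by
  have hd := det_entries u
  rw [hu, mul_zero, sub_zero] at hd
  obtain ⟨x, rfl⟩ := mem_T_iff_exists.mp hg
  rw [mem_T_iff]
  simp only [mul_entry, inv_zero_zero, inv_zero_one, inv_one_zero, inv_one_one, hu,
    upper_zero_zero, upper_zero_one, upper_one_zero, upper_one_one]
  exact ⟨by linear_combination hd, by ring, by linear_combination hd⟩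

theorem isSquare_mul_self_mul_iff {s x : F} (hs : s ≠ 0) :
    IsSquare (s * s * x) ↔ IsSquare x := by
  constructor
  · rintro ⟨r, hr⟩
    refine ⟨r / s, ?_⟩
    field_simp
    linear_combination hr
  · rintro ⟨r, rfl⟩
    exact ⟨s * r, by ring⟩

theorem range_block_mul_self_mul {s : F} (hs : s ≠ 0) (e : F) :
    Set.range (block (s * s * e)) = Set.range (block e) := by
  have : block (s * s * e) = block e := by
    funext g
    have h : IsSquare (s * s * e * g 1 0) ↔ IsSquare (e * g 1 0) := by
      rw [mul_assoc (s * s), isSquare_mul_self_mul_iff hs]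
    by_cases hg : IsSquare (e * g 1 0)
    · rw [block_of_isSquare hg, block_of_isSquare (h.mpr hg)]
    · rw [block_of_not_isSquare hg, block_of_not_isSquare (mt h.mp hg)]
  rw [this]

/-- An upper triangular `u` normalizes T, and conjugation by it multiplies lower left entries by the
square `u 1 1 * u 1 1`. -/
theorem autPerm_conj_smul {u : SL(2, F)} (hu : u 1 0 = 0) :
    autPerm (MulAut.conj u) • Set.range (block (1 : F)) = Set.range (block 1) := by
  have hd := det_entries u
  rw [hu, mul_zero, sub_zero] at hd
  have hu₁ : u 1 1 ≠ 0 := right_ne_zero_of_mul_eq_one hd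
  refine autPerm_smul_range_block (autPerm_smul_T fun g => ⟨fun h => ?_, conj_mem_T hu⟩)
    (fun g => ?_)
  · have := conj_mem_T (u := u⁻¹) (by simp [inv_one_zero, hu]) h
    rwa [MulAut.conj_apply, show u⁻¹ * (u * g * u⁻¹) * u⁻¹⁻¹ = g by group] at this
  · have h : MulAut.conj u g 1 0 = u 1 1 * u 1 1 * g 1 0 := by
      simp only [MulAut.conj_apply, mul_entry, inv_zero_zero, inv_one_zero, hu]
      ring
    rw [h, one_mul, one_mul, isSquare_mul_self_mul_iff hu₁]

theorem rho_smul (h : SL(2, F)) (B : Set SL(2, F)) : rho h • B = B * {h} := by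
  rw [Set.mul_singleton]
  rfl

theorem rho_smul_mul_singleton (h g : SL(2, F)) (B : Set SL(2, F)) :
    rho h • (B * {g}) = B * {g * h} := by
  rw [rho_smul, mul_assoc, Set.singleton_mul_singleton]

theorem rho_neg_one_smul_block (e : F) (g : SL(2, F)) :
    rho (-1 : SL(2, F)) • block e g = block (-e) (-g) := by
  have h₁ : e * g 1 0 = -e * (-g) 1 0 := by simp
  by_cases h : IsSquare (e * g 1 0)
  · rw [block_of_isSquare h, block_of_isSquare (h₁ ▸ h), rho_smul_mul_singleton, mul_neg, mul_one]
  · rw [block_of_not_isSquare h, block_of_not_isSquare (h₁ ▸ h), rho_smul]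
    have : (T F : Set SL(2, F)) * {-1} = {-1} * (T F : Set SL(2, F)) := by
      simp [Set.mul_singleton, Set.singleton_mul]
    rw [mul_assoc, this, ← mul_assoc, Set.singleton_mul_singleton, mul_neg, mul_one]

theorem rho_neg_one_smul_range_block (e : F) :
    rho (-1 : SL(2, F)) • Set.range (block e) = Set.range (block (-e)) := by
  rw [Set.smul_set_range]
  simp_rw [rho_neg_one_smul_block]
  exact neg_surjective.range_comp (block (-e))

/-- Both families are partitions, so a block of the first is the block of the second through any of
its points; here the point is `g * h`. -/
theorem rho_smul_block_eq {e : F} {h : SL(2, F)} {α : MulAut SL(2, F)}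
    (hα : rho h • Set.range (block e) = autPerm α • Set.range (block (1 : F))) (g : SL(2, F)) :
    rho h • block e g = autPerm α • block 1 (α⁻¹ (g * h)) := by
  have h₁ : rho h • block e g ∈ autPerm α • Set.range (block (1 : F)) :=
    hα ▸ Set.smul_mem_smul_set ⟨g, rfl⟩
  obtain ⟨_, ⟨x, rfl⟩, hx⟩ := h₁
  have h₂ : g * h ∈ rho h • block e g := ⟨g, self_mem_block e g, rfl⟩
  simp only at hx
  rw [← hx] at h₂ ⊢
  obtain ⟨y, hy, hy'⟩ := h₂
  have hy₂ : α y = g * h := hy'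
  rw [block_eq_of_mem hy, ← hy₂, MulAut.inv_apply_self]

theorem one_zero_eq_zero_of_inv_conj_mem_T {u : SL(2, F)} (hu : u⁻¹ * upper 1 * u ∈ T F) :
    u 1 0 = 0 :=
  one_zero_eq_zero_of_upper_one_mul_eq hu (by group)

/-- If right translation by `h` turns the partition into blocks `block e g` into a conjugate of
`classA`, then the conjugating element normalizes `T`. -/
theorem one_zero_eq_zero_of_rho_smul {e : F} (he : e ≠ 0) {h k : SL(2, F)}
    (hk : rho h • Set.range (block e) =
      autPerm (MulAut.conj k) • Set.range (block (1 : F))) : k 1 0 = 0 := by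
  by_contra hk₀
  have key : ∀ g : SL(2, F), IsSquare (e * g 1 0) → (g * (h * k)) 1 0 = 0 := fun g hg => by
    have h₁ : upper 1 * (g * h) ∈ rho h • block e g := by
      rw [block_of_isSquare hg, rho_smul_mul_singleton]
      exact Set.mul_mem_mul (upper_mem_T 1) rfl
    rw [rho_smul_block_eq hk, Set.mem_smul_set_iff_inv_smul_mem, ← map_inv] at h₁
    change (MulAut.conj k)⁻¹ (upper 1 * (g * h)) ∈ _ at h₁
    rw [← map_inv, MulAut.conj_apply, MulAut.conj_apply] at h₁
    apply one_zero_eq_zero_of_inv_conj_mem_T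
    -- If the matching block is a right coset of a conjugate of T, then `k` normalizes T, which is
    -- excluded. If it is a left coset, then `g * (h * k)` normalizes T.
    by_cases hs : IsSquare (1 * (k⁻¹ * (g * h) * k⁻¹⁻¹) 1 0)
    · rw [block_of_isSquare hs, mem_T_mul_singleton] at h₁
      refine absurd (one_zero_eq_zero_of_inv_conj_mem_T ?_) hk₀
      convert h₁ using 1
      group
    · rw [block_of_not_isSquare hs, mem_singleton_mul_T] at h₁
      convert h₁ using 1
      group
  have h₁ := key 1 (by simp)
  -- The choices 1 and `lower e` together make the first column of `h * k` vanish, against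
  -- determinant 1.
  have h₂ := key (lower e) (by simp)
  rw [one_mul] at h₁
  rw [mul_entry, h₁, lower_one_zero, mul_zero, add_zero] at h₂
  have hd := det_entries (h * k)
  rw [h₁, (mul_eq_zero.mp h₂).resolve_left he] at hd
  simp at hd

/-- If right translation by `h` turns the partition into blocks `block e g` into a conjugate of
`classA`, then `h` is upper triangular and the class of its diagonal entries modulo squares is
determined by `e`. -/
theorem one_zero_eq_zero_and_isSquare_of_rho_smul {e ν : F} (he : e ≠ 0) (hν : ¬IsSquare ν)
    {h k : SL(2, F)} (hk : rho h • Set.range (block e) =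
      autPerm (MulAut.conj k) • Set.range (block (1 : F))) :
    h 1 0 = 0 ∧ IsSquare (e * h 0 0) := by
  have hk₀ := one_zero_eq_zero_of_rho_smul he hk
  rw [autPerm_conj_smul hk₀, ← one_smul (Equiv.Perm SL(2, F)) (Set.range (block (1 : F))),
    ← map_one (MulAut.toPerm SL(2, F))] at hk
  have key : ∀ g : SL(2, F), rho h • block e g = block 1 (g * h) := fun g => by
    have := rho_smul_block_eq hk g
    rwa [autPerm, map_one, one_smul] at this
  have square : ∀ g : SL(2, F), IsSquare (e * g 1 0) → IsSquare ((g * h) 1 0) := fun g hg => by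
    by_contra hgh
    have := key g
    rw [block_of_isSquare hg, block_of_not_isSquare (by rwa [one_mul]),
      rho_smul_mul_singleton] at this
    rw [one_zero_eq_zero_of_cosets_eq this] at hgh
    exact hgh IsSquare.zero
  have h₁₀ : h 1 0 = 0 := by
    by_contra h₀
    have hν₀ : ν / h 1 0 ≠ 0 := div_ne_zero (fun h => hν (h ▸ IsSquare.zero)) h₀
    -- A diagonal matrix has lower left entry 0, a square, while this choice gives `g * h` the
    -- nonsquare lower left entry `ν`.
    obtain ⟨g, h₁, h₂⟩ : ∃ g : SL(2, F), g 1 0 = 0 ∧ g 1 1 = ν / h 1 0 :=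
      ⟨⟨!![(ν / h 1 0)⁻¹, 0; 0, ν / h 1 0], by
        rw [Matrix.det_fin_two_of, inv_mul_cancel₀ hν₀, mul_zero, sub_zero]⟩, rfl, rfl⟩
    have := square g (by simp [h₁])
    rw [mul_entry, h₁, h₂, zero_mul, zero_add, div_mul_cancel₀ _ h₀] at this
    exact hν this
  have := square (lower e) (by simp)
  rw [mul_entry, h₁₀, lower_one_zero, mul_zero, add_zero] at this
  exact ⟨h₁₀, this⟩

end Blocks

/-! ### The group 𝔄 ⋉ R and the faithful action of PΣL(2,F). -/

section Affine

variable {F : Type*} [Field F]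

theorem autPerm_mul_rho (α : MulAut SL(2, F)) (h : SL(2, F)) :
    autPerm α * rho h = rho (α h) * autPerm α := by
  ext1 x
  exact map_mul α x h

theorem rho_apply_one (h : SL(2, F)) : rho h 1 = h := one_mul h

theorem autPerm_mem_autGroup (α : MulAut SL(2, F)) : autPerm α ∈ autGroup F := ⟨α, rfl⟩

theorem autPerm_mem_affineGroup (α : MulAut SL(2, F)) : autPerm α ∈ affineGroup F :=
  Subgroup.mem_sup_right (autPerm_mem_autGroup α)

theorem rho_mem_affineGroup (h : SL(2, F)) : rho h ∈ affineGroup F :=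
  Subgroup.mem_sup_left ⟨h, rfl⟩

theorem affineGroup_isInternalSemidirectProduct :
    IsInternalSemidirectProduct (affineGroup F) (rightGroup F) (autGroup F) where
  sup_eq := rfl
  disjoint := by
    rw [Subgroup.disjoint_def]
    rintro _ ⟨h, rfl⟩ ⟨α, hα⟩
    have : rho h 1 = 1 := by rw [← hα]; exact map_one α
    rw [rho_apply_one] at this
    rw [this]
    exact Equiv.mulRight_one
  conj_mem := by
    rintro _ ⟨α, rfl⟩ _ ⟨h, rfl⟩
    exact ⟨α h, by rw [eq_mul_inv_iff_mul_eq]; exact (autPerm_mul_rho α h).symm⟩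

theorem exists_eq_rho_mul_autPerm {f : Equiv.Perm SL(2, F)} (hf : f ∈ affineGroup F) :
    ∃ h α, f = rho h * autPerm α := by
  have hn : autGroup F ≤ Subgroup.normalizer (rightGroup F : Set (Equiv.Perm SL(2, F))) := by
    intro a ha
    have H := affineGroup_isInternalSemidirectProduct (F := F)
    rw [Subgroup.mem_set_normalizer_iff]
    refine fun n => ⟨H.conj_mem a ha n, fun h => ?_⟩
    have := H.conj_mem a⁻¹ ((autGroup F).inv_mem ha) _ h
    rwa [show a⁻¹ * (a * n * a⁻¹) * a⁻¹⁻¹ = n by group] at this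
  rw [affineGroup, ← SetLike.mem_coe, Subgroup.coe_mul_of_right_le_normalizer_left _ _ hn] at hf
  obtain ⟨_, ⟨h, rfl⟩, _, ⟨α, rfl⟩, rfl⟩ := hf
  exact ⟨h, α, rfl⟩

theorem mem_pSigmaLGroup_iff {f : Equiv.Perm SL(2, F)} :
    f ∈ pSigmaLGroup F ↔ ∃ u σ, f = autPerm (MulAut.conj u * fieldAut F σ) := by
  constructor
  · rintro ⟨⟨x, σ⟩, rfl⟩
    induction x using QuotientGroup.induction_on with
    | H u => exact ⟨u, σ, rfl⟩
  · rintro ⟨u, σ, rfl⟩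
    exact ⟨⟨(u : PSL(2, F)), σ⟩, rfl⟩

theorem pSigmaLAut_injective : Function.Injective (pSigmaLAut F) := by
  rw [injective_iff_map_eq_one]
  rintro ⟨x, σ⟩ h
  induction x using QuotientGroup.induction_on with
  | H u =>
    change MulAut.conj u * fieldAut F σ = 1 at h
    have hu : ∀ x, u * upper (σ x) = upper x * u := fun x => by
      have := DFunLike.congr_fun h (upper x)
      rw [MulAut.mul_apply, fieldAut_upper, MulAut.conj_apply, mul_inv_eq_iff_eq_mul] at this
      exact this
    have hl : ∀ x, u * lower (σ x) = lower x * u := fun x => by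
      have := DFunLike.congr_fun h (lower x)
      rw [MulAut.mul_apply, fieldAut_lower, MulAut.conj_apply, mul_inv_eq_iff_eq_mul] at this
      exact this
    have e₁ := fun x i j => congrArg (fun g : SL(2, F) => g i j) (hu x)
    have e₂ := fun x i j => congrArg (fun g : SL(2, F) => g i j) (hl x)
    simp only [mul_entry] at e₁ e₂
    -- Since `σ 1 = 1`, the relations at `x = 1` say that `u` commutes with `upper 1` and `lower 1`,
    -- hence is scalar. The remaining relations then force `σ = 1`.
    have h₁₀ : u 1 0 = 0 := by simpa using e₁ 1 0 0
    have h₀₁ : u 0 1 = 0 := by simpa using e₂ 1 0 0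
    have h₁₁ : u 0 0 = u 1 1 := by simpa [h₀₁] using e₁ 1 0 1
    have hd := det_entries u
    have h₀ : u 1 1 ≠ 0 := fun h => by simp [h₁₀, h] at hd
    have hσ : σ = 1 := by
      ext x
      have : u 1 1 * σ x = x * u 1 1 := by simpa [h₀₁, h₁₁] using e₁ x 0 1
      exact mul_left_cancel₀ h₀ (this.trans (mul_comm _ _))
    have hc : u ∈ Subgroup.center SL(2, F) := by
      rw [Subgroup.mem_center_iff]
      intro g
      apply ext_entries <;> simp only [mul_entry, h₁₀, h₀₁, h₁₁] <;> ring
    rw [hσ, (QuotientGroup.eq_one_iff u).mpr hc]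
    rfl

end Affine

/-! ### Computation of the stabilizer of π_odd. -/

section Stabilizer

variable {F : Type*} [Field F]

theorem piOdd_eq_range : piOdd F =
    Set.range fun h : SL(2, F) => autPerm (MulAut.conj h) • Set.range (block (1 : F)) := by
  have key : ∀ h : SL(2, F), (fun B : Set SL(2, F) => {h⁻¹} * B * {h}) '' classA F =
      autPerm (MulAut.conj h⁻¹) • Set.range (block (1 : F)) := fun h => by
    rw [classA_eq_range_block]
    change _ = (fun B : Set SL(2, F) => autPerm (MulAut.conj h⁻¹) • B) '' _
    congr 1
    funext B
    rw [Set.singleton_mul, Set.mul_singleton, Set.image_image]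
    change _ = (fun x => h⁻¹ * x * h⁻¹⁻¹) '' B
    rw [inv_inv]
  ext X
  constructor
  · rintro ⟨h, rfl⟩
    exact ⟨h⁻¹, (key h).symm⟩
  · rintro ⟨h, rfl⟩
    exact ⟨h⁻¹, by rw [key, inv_inv]⟩

theorem autPerm_conj_mem_stabPiOdd (u : SL(2, F)) : autPerm (MulAut.conj u) ∈ stabPiOdd F := by
  refine ⟨autPerm_mem_affineGroup _, ?_⟩
  change autPerm (MulAut.conj u) • piOdd F = piOdd F
  rw [piOdd_eq_range, Set.smul_set_range]
  simp_rw [smul_smul, ← map_mul]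
  exact (Group.mulLeft_bijective u).surjective.range_comp
    fun h : SL(2, F) => autPerm (MulAut.conj h) • Set.range (block (1 : F))

theorem autPerm_mul_conj (α : MulAut SL(2, F)) (h : SL(2, F)) :
    autPerm α * autPerm (MulAut.conj h) = autPerm (MulAut.conj (α h)) * autPerm α := by
  rw [← map_mul, ← map_mul]
  congr 1
  ext1 x
  simp

theorem rho_neg_one_mul_conj (h : SL(2, F)) :
    rho (-1) * autPerm (MulAut.conj h) = autPerm (MulAut.conj h) * rho (-1) := by
  rw [autPerm_mul_rho]
  simp

/-- A permutation that normalizes the inner automorphisms and fixes one member of the conjugacy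
family π_odd permutes the whole family. -/
theorem mem_stabPiOdd_of_smul {f : Equiv.Perm SL(2, F)} (hf : f ∈ affineGroup F)
    (α : MulAut SL(2, F))
    (hα : ∀ h, f * autPerm (MulAut.conj h) = autPerm (MulAut.conj (α h)) * f)
    (hA : f • Set.range (block (1 : F)) = Set.range (block 1)) : f ∈ stabPiOdd F := by
  refine ⟨hf, ?_⟩
  change f • piOdd F = piOdd F
  rw [piOdd_eq_range, Set.smul_set_range]
  simp_rw [smul_smul, hα, mul_smul, hA]
  exact α.surjective.range_comp
    fun h : SL(2, F) => autPerm (MulAut.conj h) • Set.range (block (1 : F))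

theorem autPerm_fieldAut_mem_stabPiOdd (σ : F ≃+* F) : autPerm (fieldAut F σ) ∈ stabPiOdd F :=
  mem_stabPiOdd_of_smul (autPerm_mem_affineGroup _) _ (autPerm_mul_conj _)
    (autPerm_fieldAut_smul σ)

theorem pSigmaLGroup_le_stabPiOdd : pSigmaLGroup F ≤ stabPiOdd F := fun f hf => by
  obtain ⟨u, σ, rfl⟩ := mem_pSigmaLGroup_iff.mp hf
  rw [autPerm, map_mul]
  exact mul_mem (autPerm_conj_mem_stabPiOdd u) (autPerm_fieldAut_mem_stabPiOdd σ)

theorem rho_neg_one_mem_stabPiOdd (h : IsSquare (-1 : F)) : rho (-1) ∈ stabPiOdd F := by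
  refine mem_stabPiOdd_of_smul (rho_mem_affineGroup _) 1 rho_neg_one_mul_conj ?_
  obtain ⟨s, hs⟩ := h
  have hs₀ : s ≠ 0 := fun h => by simp [h] at hs
  rw [rho_neg_one_smul_range_block, hs, ← mul_one (s * s), range_block_mul_self_mul hs₀]

theorem gamma_cMat_mul_rho_mem_stabPiOdd : gamma (cMat F) * rho (-1) ∈ stabPiOdd F := by
  refine mem_stabPiOdd_of_smul (mul_mem (autPerm_mem_affineGroup _) (rho_mem_affineGroup _))
    (gammaAut (cMat F)) (fun h => ?_) ?_
  · change autPerm (gammaAut (cMat F)) * _ * _ = _ * (autPerm (gammaAut (cMat F)) * _)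
    rw [mul_assoc, rho_neg_one_mul_conj, ← mul_assoc, autPerm_mul_conj, mul_assoc]
  · change (autPerm (gammaAut (cMat F)) * _) • _ = _
    rw [mul_smul, rho_neg_one_smul_range_block, gammaAut_cMat, autPerm_diagAut_smul]
    simp

/-- Conjugating by 1 and `weyl 1` makes `h` diagonal, `lower 1` makes its diagonal entries equal,
and determinant 1 leaves ±1. -/
theorem eq_one_or_eq_neg_one_of_conj_one_zero {h : SL(2, F)}
    (hh : ∀ j : SL(2, F), (j * h * j⁻¹) 1 0 = 0) : h = 1 ∨ h = -1 := by
  have h₁ := hh 1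
  have h₂ := hh (weyl 1)
  have h₃ := hh (lower 1)
  obtain ⟨-, -, w₃, w₄⟩ := weyl_entries (one_ne_zero (α := F))
  simp [mul_entry, inv_zero_zero, inv_one_zero, w₃, w₄] at h₁ h₂ h₃
  have h₄ : h 1 1 = h 0 0 := by linear_combination h₁ - h₃ - h₂
  have hd := det_entries h
  have h₅ : h 0 0 * h 0 0 = 1 := by linear_combination hd + h 0 1 * h₁ - h 0 0 * h₄
  rcases mul_self_eq_one_iff.mp h₅ with h₆ | h₆
  · left
    apply ext_entries <;> simp [h₁, h₂, h₄, h₆]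
  · right
    apply ext_entries <;> simp [h₁, h₂, h₄, h₆]

theorem eq_of_rho_mul_diagAut_mem_stabPiOdd {e ν : F} (he : e ≠ 0) (hν : ¬IsSquare ν)
    {h : SL(2, F)} (hs : rho h * autPerm (diagAut e he) ∈ stabPiOdd F) :
    (h = 1 ∧ IsSquare e) ∨ (h = -1 ∧ IsSquare (-e)) := by
  have key : ∀ j : SL(2, F), (j * h * j⁻¹) 1 0 = 0 ∧ IsSquare (e * (j * h * j⁻¹) 0 0) :=
      fun j => by
    -- The inner factor on the right is chosen so that, moved past the diagonal automorphism, it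
    -- cancels conjugation by `j`. Only `h` gets conjugated, and `e` is unchanged.
    have h₁ : rho (j * h * j⁻¹) * autPerm (diagAut e he) ∈ stabPiOdd F := by
      have := mul_mem (mul_mem (autPerm_conj_mem_stabPiOdd j) hs)
        (autPerm_conj_mem_stabPiOdd ((diagAut e he)⁻¹ j⁻¹))
      have h₀ : autPerm (diagAut e he) * autPerm (MulAut.conj ((diagAut e he)⁻¹ j⁻¹)) =
          autPerm (MulAut.conj j⁻¹) * autPerm (diagAut e he) := by
        rw [autPerm_mul_conj, MulAut.apply_inv_self]
      have h₁ : autPerm (MulAut.conj j) * autPerm (MulAut.conj j⁻¹) = 1 := by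
        rw [← map_mul, ← map_mul, mul_inv_cancel, map_one, map_one]
      rwa [← mul_assoc, autPerm_mul_rho, mul_assoc, h₀, mul_assoc, ← mul_assoc (autPerm _), h₁,
        one_mul] at this
    have h₂ : (rho (j * h * j⁻¹) * autPerm (diagAut e he)) • piOdd F = piOdd F := h₁.2
    have h₃ : (rho (j * h * j⁻¹) * autPerm (diagAut e he)) • Set.range (block (1 : F)) ∈
        piOdd F := by
      rw [← h₂]
      apply Set.smul_mem_smul_set
      rw [piOdd_eq_range]
      exact ⟨1, by simp [autPerm]⟩
    rw [piOdd_eq_range, mul_smul, autPerm_diagAut_smul, mul_one] at h₃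
    obtain ⟨k, hk⟩ := h₃
    exact one_zero_eq_zero_and_isSquare_of_rho_smul he hν hk.symm
  have h₁ := (key 1).2
  simp only [one_mul, inv_one, mul_one] at h₁
  rcases eq_one_or_eq_neg_one_of_conj_one_zero fun j => (key j).1 with rfl | rfl
  · exact Or.inl ⟨rfl, by simpa using h₁⟩
  · exact Or.inr ⟨rfl, by simpa using h₁⟩

theorem autPerm_diagAut_mem_pSigmaLGroup {e : F} (he : e ≠ 0) (h : IsSquare e) :
    autPerm (diagAut e he) ∈ pSigmaLGroup F := by
  obtain ⟨s, rfl⟩ := h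
  obtain ⟨u, hu⟩ := exists_conj_eq_diagAut_sq s he
  exact mem_pSigmaLGroup_iff.mpr ⟨u, 1, by rw [map_one, mul_one, hu]⟩

theorem autPerm_conj_mem_pSigmaLGroup (u : SL(2, F)) :
    autPerm (MulAut.conj u) ∈ pSigmaLGroup F :=
  mem_pSigmaLGroup_iff.mpr ⟨u, 1, by rw [map_one, mul_one]⟩

theorem autPerm_fieldAut_mem_pSigmaLGroup (σ : F ≃+* F) :
    autPerm (fieldAut F σ) ∈ pSigmaLGroup F :=
  mem_pSigmaLGroup_iff.mpr ⟨1, σ, by rw [map_one, one_mul]⟩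

/-- Modulo `PΣL(2,F)` on both sides, every element of the stabilizer is the product of a right
translation and a diagonal automorphism. -/
theorem stabPiOdd_le [Finite F] (h2 : (2 : F) ≠ 0) {P : Subgroup (Equiv.Perm SL(2, F))}
    (hP : pSigmaLGroup F ≤ P)
    (hneg : ∀ (e : F) (he : e ≠ 0), IsSquare (-e) → rho (-1) * autPerm (diagAut e he) ∈ P) :
    stabPiOdd F ≤ P := by
  intro f hf
  obtain ⟨h, α, rfl⟩ := exists_eq_rho_mul_autPerm hf.1
  obtain ⟨u, e, he, σ, rfl⟩ := exists_eq_conj_mul_diagAut_mul_fieldAut h2 α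
  obtain ⟨ν, hν⟩ := FiniteField.exists_nonsquare (F := F) fun h => h2 (by
    have := ringChar.Nat.cast_ringChar (R := F)
    rwa [h, Nat.cast_ofNat] at this)
  -- The inner and field factors lie in both the stabilizer and `P`, so only the middle factor has
  -- to be examined.
  have key : rho h * autPerm (MulAut.conj u * (diagAut e he * fieldAut F σ)) =
      autPerm (MulAut.conj u) * (rho ((MulAut.conj u)⁻¹ h) * autPerm (diagAut e he)) *
        autPerm (fieldAut F σ) := by
    rw [← mul_assoc (autPerm _) (rho _), autPerm_mul_rho, MulAut.apply_inv_self]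
    simp only [autPerm, map_mul, mul_assoc]
  rw [key] at hf ⊢
  have hd : rho ((MulAut.conj u)⁻¹ h) * autPerm (diagAut e he) ∈ stabPiOdd F :=
    ((stabPiOdd F).mul_mem_cancel_left (autPerm_conj_mem_stabPiOdd u)).mp
      (((stabPiOdd F).mul_mem_cancel_right (autPerm_fieldAut_mem_stabPiOdd σ)).mp hf)
  refine mul_mem (mul_mem (hP (autPerm_conj_mem_pSigmaLGroup u)) ?_)
    (hP (autPerm_fieldAut_mem_pSigmaLGroup σ))
  rcases eq_of_rho_mul_diagAut_mem_stabPiOdd he hν hd with ⟨h₁, h₂⟩ | ⟨h₁, h₂⟩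
  · rw [h₁, show rho (1 : SL(2, F)) = 1 from Equiv.mulRight_one, one_mul]
    exact hP (autPerm_diagAut_mem_pSigmaLGroup he h₂)
  · rw [h₁]
    exact hneg e he h₂

theorem eq_one_or_eq_of_mem_zpowers {G : Type*} [Group G] {s f : G} (hs : s ^ 2 = 1)
    (hf : f ∈ Subgroup.zpowers s) : f = 1 ∨ f = s := by
  obtain ⟨n, rfl⟩ := hf
  rcases Int.even_or_odd' n with ⟨m, rfl | rfl⟩
  · left
    simp only [zpow_mul, zpow_ofNat, hs, one_zpow]
  · right
    simp only [zpow_add, zpow_mul, zpow_ofNat, hs, one_zpow, one_mul, pow_one]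

theorem autPerm_mul_rho_neg_one_sq {α : MulAut SL(2, F)} (hα : α * α = 1)
    (hneg : α (-1) = -1) : (autPerm α * rho (-1)) ^ 2 = 1 := by
  ext1 x
  have : α (α x) = x := DFunLike.congr_fun hα x
  change α (α (x * -1) * -1) = x
  rw [map_mul, map_mul, map_mul, this, hneg, hneg]
  simp

/-- The generator is an involution sending 1 to -1, whereas PΣL(2,F) acts by automorphisms and fixes
1. -/
theorem disjoint_pSigmaLGroup_zpowers (h2 : (2 : F) ≠ 0) {α : MulAut SL(2, F)} (hα : α * α = 1)
    (hneg : α (-1) = -1) :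
    Disjoint (pSigmaLGroup F) (Subgroup.zpowers (autPerm α * rho (-1))) := by
  rw [Subgroup.disjoint_def]
  intro f hf hf'
  rcases eq_one_or_eq_of_mem_zpowers (autPerm_mul_rho_neg_one_sq hα hneg) hf' with rfl | rfl
  · rfl
  · obtain ⟨u, σ, h⟩ := mem_pSigmaLGroup_iff.mp hf
    have h₁ : α (1 * -1) = (MulAut.conj u * fieldAut F σ) 1 := DFunLike.congr_fun h 1
    rw [map_one, one_mul, hneg] at h₁
    have h₃ := congrArg (fun g : SL(2, F) => g 0 0) h₁
    simp at h₃
    exact absurd (by linear_combination -h₃) h2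

theorem two_ne_zero_of_odd_card [Finite F] (hodd : Odd (Nat.card F)) : (2 : F) ≠ 0 := by
  have := Fintype.ofFinite F
  intro h
  have h' : ringChar F = 2 := by
    have : ringChar F ∣ 2 := (ringChar.spec F 2).mp (by exact_mod_cast h)
    exact ((Nat.dvd_prime Nat.prime_two).mp this).resolve_left CharP.ringChar_ne_one
  have := FiniteField.even_card_iff_char_two.mp h'
  rw [← Nat.card_eq_fintype_card] at this
  exact absurd hodd (by rwa [Nat.not_odd_iff])

theorem stabPiOdd_isInternalDirectProduct [Finite F] (h2 : (2 : F) ≠ 0)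
    (hq : Nat.card F ≡ 1 [MOD 4]) :
    IsInternalDirectProduct (stabPiOdd F) (pSigmaLGroup F) (Subgroup.zpowers (rho (-1))) := by
  have hsq : IsSquare (-1 : F) := by
    have := Fintype.ofFinite F
    rw [FiniteField.isSquare_neg_one_iff, ← Nat.card_eq_fintype_card, hq]
    decide
  refine ⟨le_antisymm (sup_le pSigmaLGroup_le_stabPiOdd ?_) ?_, ?_, ?_⟩
  · exact Subgroup.zpowers_le.mpr (rho_neg_one_mem_stabPiOdd hsq)
  · refine stabPiOdd_le h2 le_sup_left fun e he hse => ?_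
    -- Here -1 is a square, so `e` is one too and the diagonal factor is inner.
    have he' : IsSquare e := by simpa using hsq.mul hse
    exact mul_mem (Subgroup.mem_sup_right (Subgroup.mem_zpowers _))
      (Subgroup.mem_sup_left (autPerm_diagAut_mem_pSigmaLGroup he he'))
  · simpa [autPerm] using disjoint_pSigmaLGroup_zpowers h2 (one_mul 1) rfl
  · rintro f hf _ ⟨n, rfl⟩
    obtain ⟨u, σ, rfl⟩ := mem_pSigmaLGroup_iff.mp hf
    apply Commute.zpow_right
    have : (MulAut.conj u * fieldAut F σ) (-1) = -1 := by
      have : fieldAut F σ (-1) = -1 := by apply ext_entries <;> simp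
      rw [MulAut.mul_apply, this]
      simp
    rw [Commute, SemiconjBy, autPerm_mul_rho, this]

theorem gammaAut_cMat_mul_self : gammaAut (cMat F) * gammaAut (cMat F) = 1 := by
  rw [gammaAut_cMat]
  ext1 x
  apply ext_entries <;> simp

theorem gammaAut_cMat_neg_one : gammaAut (cMat F) (-1) = -1 := by
  rw [gammaAut_cMat]
  apply ext_entries <;> simp

theorem gamma_cMat_mul_conj_mem {n : Equiv.Perm SL(2, F)} (hn : n ∈ pSigmaLGroup F) :
    gamma (cMat F) * rho (-1) * n * (gamma (cMat F) * rho (-1))⁻¹ ∈ pSigmaLGroup F := by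
  obtain ⟨u, σ, rfl⟩ := mem_pSigmaLGroup_iff.mp hn
  refine mem_pSigmaLGroup_iff.mpr ⟨gammaAut (cMat F) u, σ, ?_⟩
  rw [mul_inv_eq_iff_eq_mul]
  ext1 x
  have h : ∀ y, gammaAut (cMat F) (fieldAut F σ y) = fieldAut F σ (gammaAut (cMat F) y) :=
    fun y => by
      rw [gammaAut_cMat]
      apply ext_entries <;> simp
  have hσ : fieldAut F σ (-1) = -1 := by apply ext_entries <;> simp
  change gammaAut (cMat F) (u * fieldAut F σ x * u⁻¹ * -1) =
    gammaAut (cMat F) u * fieldAut F σ (gammaAut (cMat F) (x * -1)) * (gammaAut (cMat F) u)⁻¹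
  simp only [map_mul, map_inv, h, gammaAut_cMat_neg_one, hσ]
  simp

theorem stabPiOdd_isInternalSemidirectProduct [Finite F] (h2 : (2 : F) ≠ 0) :
    IsInternalSemidirectProduct (stabPiOdd F) (pSigmaLGroup F)
      (Subgroup.zpowers (gamma (cMat F) * rho (-1))) := by
  refine ⟨le_antisymm (sup_le pSigmaLGroup_le_stabPiOdd ?_) ?_, ?_, ?_⟩
  · exact Subgroup.zpowers_le.mpr gamma_cMat_mul_rho_mem_stabPiOdd
  · refine stabPiOdd_le h2 le_sup_left fun e he hse => ?_
    have he' : -e ≠ 0 := neg_ne_zero.mpr he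
    -- Since `gammaAut (cMat F)` is the diagonal automorphism with parameter -1, splitting it off
    -- leaves the parameter `-e`, a square, whose automorphism is inner.
    have h : rho (-1) * autPerm (diagAut e he) =
        gamma (cMat F) * rho (-1) * autPerm (diagAut (-e) he') := by
      ext1 x
      change diagAut e he x * -1 = gammaAut (cMat F) (diagAut (-e) he' x * -1)
      rw [map_mul, gammaAut_cMat_neg_one, gammaAut_cMat]
      congr 1
      apply ext_entries <;> simp
    rw [h]
    exact mul_mem (Subgroup.mem_sup_right (Subgroup.mem_zpowers _))
      (Subgroup.mem_sup_left (autPerm_diagAut_mem_pSigmaLGroup he' hse))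
  · exact disjoint_pSigmaLGroup_zpowers h2 gammaAut_cMat_mul_self gammaAut_cMat_neg_one
  · intro h hh n hn
    rcases eq_one_or_eq_of_mem_zpowers
      (autPerm_mul_rho_neg_one_sq gammaAut_cMat_mul_self gammaAut_cMat_neg_one) hh with rfl | rfl
    · simpa using hn
    · exact gamma_cMat_mul_conj_mem hn

end Stabilizer

end SLTwo

theorem mainTheorem2 (F : Type*) [Field F] [Finite F] (hodd : Odd (Nat.card F)) :
    IsInternalSemidirectProduct (SLTwo.affineGroup F) (SLTwo.rightGroup F) (SLTwo.autGroup F) ∧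
    Function.Injective (SLTwo.pSigmaLAut F) ∧
    (Nat.card F ≡ 1 [MOD 4] →
      IsInternalDirectProduct (SLTwo.stabPiOdd F) (SLTwo.pSigmaLGroup F)
        (Subgroup.zpowers (SLTwo.rho (-1)))) ∧
    (Nat.card F ≡ 3 [MOD 4] →
      IsInternalSemidirectProduct (SLTwo.stabPiOdd F) (SLTwo.pSigmaLGroup F)
        (Subgroup.zpowers (SLTwo.gamma (SLTwo.cMat F) * SLTwo.rho (-1)))) := by
  have h2 := SLTwo.two_ne_zero_of_odd_card hodd
  exact ⟨SLTwo.affineGroup_isInternalSemidirectProduct, SLTwo.pSigmaLAut_injective,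
    SLTwo.stabPiOdd_isInternalDirectProduct h2,
    fun _ => SLTwo.stabPiOdd_isInternalSemidirectProduct h2⟩
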